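/- Let $d\ge 1$, let $\mathbb N=\{0,1,2,\dots\}$, $[d]=\{1,\dots,d\}$, $X=\mathbb N^d$ and $\Gamma=\mathbb N^d$ (an additive semigroup). The height of a point $\delta=(i,n)\in[d]\times\mathbb N$ is $h(\delta)=n+i/d$, and $i$ is its seat. Distinct points have distinct heights. For $s\in\mathbb N$, let $\delta+s/d$ be the unique point of $[d]\times\mathbb N$ of height $h(\delta)+s/d$. For $x=(n_1,\dots,n_d)\in X$ put $\Delta(x)=\{(i,n_i): i\in[d]\}$, and let $\delta^1(x),\dots,\delta^d(x)$ be the points of $\Delta(x)$ listed in increasing order of height. Define $$n(x)=n_1+\dots+n_d,\qquad W(x)=\sum_{1\le j<k\le d}\bigl\lfloor h(\delta^k(x))-h(\delta^j(x))\bigr\rfloor .$$ For $j\in[d]$ define $g_j:X\to X$ by letting $g_j(x)$ be the element $x'\in X$ such that $\Delta(x')$ consists of the points $\delta^k(x)$ for $k<j$ and $\delta^k(x)+s_k/d$ for $k\ge j$, where $s_k$ is the least positive integer such that the seat of $\delta^k(x)+s_k/d$ is the seat of one of $\delta^j(x),\dots,\delta^d(x)$. For $a=(a_1,\dots,a_d)\in\Gamma$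 and $x\in X$ put $a\cdot x=g_1^{a_1}\circ\dots\circ g_d^{a_d}(x)$. Then for every $x_0\in X$ and every finitely generated subsemigroup $\Gamma'\subseteq\Gamma$ (containing $0$ or not), writing $\Gamma'\cdot x_0=\{a\cdot x_0: a\in\Gamma'\}\subseteq X$, the series $$\sum_{x\in\Gamma'\cdot x_0}t^{n(x)}q^{W(x)}$$ converges coefficientwise in $\mathbb Z[[t,q]]$ and is a rational function of $t$ and $q$; that is, it equals $P/Q$ for some polynomials $P,Q\in\mathbb Z[t,q]$ with $Q(0,0)=1$. -/

import Mathlib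

open scoped MvPowerSeries.WithPiTopology

namespace SpiralShift

/-- The set `X = ℕ^d` of configurations `x = (n_1, …, n_d)`.  The seat called `i ∈ {1, …, d}` in
the usual indexing is `i - 1 : Fin d` here. -/
abbrev Config (d : ℕ) : Type := Fin d → ℕ

/-- The points `(i, n)` of `[d] × ℕ`: a seat `i` and a level `n`. -/
abbrev Point (d : ℕ) : Type := Fin d × ℕ

/-- The height `n + i / d` of a point `(i, n)`, where `i ∈ {1, …, d}`. -/
def height {d : ℕ} (δ : Point d) : ℚ := (δ.2 : ℚ) + ((δ.1 : ℕ) + 1 : ℚ) / (d : ℚ)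

/-- Distinct points have distinct heights. -/
theorem height_injective (d : ℕ) : Function.Injective (height (d := d)) := by
  rintro ⟨i, m⟩ ⟨j, n⟩ h
  have hd : 0 < d := i.pos
  have hd' : (d : ℚ) ≠ 0 := by exact_mod_cast hd.ne'
  simp only [height] at h
  field_simp at h
  have h1 : d * m + (i : ℕ) = d * n + (j : ℕ) := by
    have h2 : (d : ℚ) * m + ((i : ℕ) + 1) = d * n + ((j : ℕ) + 1) := by linarith
    have h3 : d * m + ((i : ℕ) + 1) = d * n + ((j : ℕ) + 1) := by exact_mod_cast h2
    omega
  have hm : m = n := by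
    have h4 := congrArg (fun z => z / d) h1
    simpa [Nat.mul_add_div hd, Nat.div_eq_of_lt i.isLt, Nat.div_eq_of_lt j.isLt] using h4
  subst hm
  have hij : i = j := Fin.ext (by omega)
  subst hij
  rfl

/-- The point `δ + s/d`, reached from `δ` by `s` steps upwards along the spiral
`(1, n), (2, n), …, (d, n), (1, n + 1), …`. -/
def shift {d : ℕ} (δ : Point d) (s : ℕ) : Point d :=
  (⟨((δ.1 : ℕ) + s) % d, Nat.mod_lt _ δ.1.pos⟩, δ.2 + ((δ.1 : ℕ) + s) / d)

/-- `δ + s/d` has height `h(δ) + s/d`; by `height_injective` it is the unique such point. -/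
theorem height_shift {d : ℕ} (δ : Point d) (s : ℕ) :
    height (shift δ s) = height δ + (s : ℚ) / (d : ℚ) := by
  have hd : (d : ℚ) ≠ 0 := by exact_mod_cast δ.1.pos.ne'
  have h : ((d * (((δ.1 : ℕ) + s) / d) + ((δ.1 : ℕ) + s) % d : ℕ) : ℚ) = ((δ.1 : ℕ) + s : ℕ) := by
    rw [Nat.div_add_mod]
  push_cast at h
  simp only [height, shift]
  push_cast
  field_simp
  linarith

/-- The seats of a configuration `x`, listed in increasing order of the heights of the points
`(i, x i)`. -/
def seat {d : ℕ} (x : Config d) : Equiv.Perm (Fin d) := Tuple.sort fun i => height (i, x i)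

/-- The point `δ^k(x)`: the `k`-th lowest point (counted from `0`) of `Δ(x) = {(i, x i)}`. -/
def point {d : ℕ} (x : Config d) (k : Fin d) : Point d := (seat x k, x (seat x k))

theorem height_point_strictMono {d : ℕ} (x : Config d) :
    StrictMono fun k => height (point x k) := by
  refine Monotone.strictMono_of_injective (Tuple.monotone_sort fun i => height (i, x i)) ?_
  intro k l h
  have h1 := height_injective d h
  exact (seat x).injective (congrArg Prod.fst h1)

/-- Some positive shift of `δ^k(x)`, `k ≥ j`, has its seat in `{i(δ^j(x)), …, i(δ^d(x))}`. -/
theorem exists_return {d : ℕ} (x : Config d) {j k : Fin d} (h : j ≤ k) :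
    ∃ s : ℕ, 0 < s ∧ ∃ l : Fin d, j ≤ l ∧ (shift (point x k) s).1 = (point x l).1 := by
  refine ⟨d, k.pos, k, h, Fin.ext ?_⟩
  simp [shift, point, Nat.mod_eq_of_lt (seat x k).isLt]

/-- The `k`-th point of `g_j(x)`: it is `δ^k(x)` if `k < j`, and `δ^k(x) + s_k/d` if `k ≥ j`, with
`s_k` the least positive integer such that the seat of `δ^k(x) + s_k/d` belongs to
`{i(δ^j(x)), …, i(δ^d(x))}`. -/
def moved {d : ℕ} (j : Fin d) (x : Config d) (k : Fin d) : Point d :=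
  if h : j ≤ k then shift (point x k) (Nat.find (exists_return x h)) else point x k

/-- The moved points occupy every seat exactly once. -/
theorem moved_seat_bijective {d : ℕ} (j : Fin d) (x : Config d) :
    Function.Bijective fun k => (moved j x k).1 := by
  have key : ∀ k l : Fin d, ∀ hk : j ≤ k, ∀ hl : j ≤ l,
      Nat.find (exists_return x hk) ≤ Nat.find (exists_return x hl) →
      (shift (point x k) (Nat.find (exists_return x hk))).1 =
        (shift (point x l) (Nat.find (exists_return x hl))).1 → k = l := by
    intro k l hk hl hle h
    set s := Nat.find (exists_return x hk) with hs
    set t := Nat.find (exists_return x hl) with ht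
    have hs0 : 0 < s := (Nat.find_spec (exists_return x hk)).1
    obtain ⟨u, hu⟩ := Nat.exists_eq_add_of_le hle
    have h1 : ((seat x k : ℕ) + s) % d = ((seat x l : ℕ) + t) % d := congrArg Fin.val h
    have h2 : ((seat x l : ℕ) + u) % d = (seat x k : ℕ) := by
      have h3 : (seat x k : ℕ) + s ≡ ((seat x l : ℕ) + u) + s [MOD d] := by
        have h4 : ((seat x l : ℕ) + u) + s = (seat x l : ℕ) + t := by omega
        rw [h4]
        exact h1
      have h5 : (seat x k : ℕ) % d = ((seat x l : ℕ) + u) % d := Nat.ModEq.add_right_cancel' s h3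
      rw [← h5, Nat.mod_eq_of_lt (seat x k).isLt]
    rcases Nat.eq_zero_or_pos u with hu0 | hu0
    · subst hu0
      rw [Nat.add_zero, Nat.mod_eq_of_lt (seat x l).isLt] at h2
      exact (seat x).injective (Fin.ext h2.symm)
    · exact absurd ⟨hu0, k, hk, Fin.ext h2⟩
        (Nat.find_min (exists_return x hl) (m := u) (by omega))
  have cross : ∀ k l : Fin d, ∀ hk : j ≤ k, ¬ j ≤ l →
      (shift (point x k) (Nat.find (exists_return x hk))).1 ≠ (point x l).1 := by
    intro k l hk hl h
    obtain ⟨m, hm, hm'⟩ := (Nat.find_spec (exists_return x hk)).2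
    have h1 : seat x m = seat x l := hm'.symm.trans h
    exact hl ((seat x).injective h1 ▸ hm)
  refine Finite.injective_iff_bijective.mp ?_
  intro k l h
  simp only [moved] at h
  split_ifs at h with hk hl hl
  · rcases le_total (Nat.find (exists_return x hk)) (Nat.find (exists_return x hl)) with hle | hle
    · exact key k l hk hl hle h
    · exact (key l k hl hk hle h.symm).symm
  · exact absurd h (cross k l hk hl)
  · exact absurd h.symm (cross l k hl hk)
  · exact (seat x).injective h

/-- The spiral shifting operator `g_j : X → X`: the configuration `g_j(x)` whose set of points
`Δ(g_j(x))` is the set of moved points. -/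
noncomputable def g {d : ℕ} (j : Fin d) (x : Config d) : Config d :=
  fun i => (moved j x ((Equiv.ofBijective _ (moved_seat_bijective j x)).symm i)).2

/-- `Δ(g_j(x)) = {moved points}`. -/
theorem range_g {d : ℕ} (j : Fin d) (x : Config d) :
    (Set.range fun i => ((i, g j x i) : Point d)) = Set.range (moved j x) := by
  set e := Equiv.ofBijective _ (moved_seat_bijective j x) with he
  have h : ∀ i, ((i, g j x i) : Point d) = moved j x (e.symm i) := fun i =>
    Prod.ext (e.apply_symm_apply i).symm rfl
  ext p
  constructor
  · rintro ⟨i, rfl⟩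
    exact ⟨e.symm i, (h i).symm⟩
  · rintro ⟨k, rfl⟩
    exact ⟨e k, by simp only [h, e.symm_apply_apply]⟩

/-- `g^a = g_1^{a_1} ∘ g_2^{a_2} ∘ ⋯ ∘ g_d^{a_d}`, the action of `a ∈ Γ = ℕ^d` on `X`. -/
noncomputable def act {d : ℕ} (a : Fin d → ℕ) : Config d → Config d :=
  (List.ofFn fun j : Fin d => (g j)^[a j]).foldr (· ∘ ·) id

/-- The orbit `S · x₀ = {a · x₀ : a ∈ S}`, as a subset of `X`. -/
def orbit {d : ℕ} (S : Set (Fin d → ℕ)) (x₀ : Config d) : Set (Config d) :=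
  {x | ∃ a ∈ S, act a x₀ = x}

/-- The size `n(x) = n_1 + ⋯ + n_d`. -/
def size {d : ℕ} (x : Config d) : ℕ := ∑ i, x i

/-- The weight `W(x) = ∑_{j < k} ⌊h(δ^k(x)) - h(δ^j(x))⌋`; all the differences are positive. -/
def weight {d : ℕ} (x : Config d) : ℕ :=
  ∑ k : Fin d, ∑ j ∈ Finset.univ.filter (· < k), ⌊height (point x k) - height (point x j)⌋₊

/-- The content `t^{n(x)} q^{W(x)}` in `ℤ⟦t, q⟧`, where `t = X 0` and `q = X 1`. -/
noncomputable def cont {d : ℕ} (x : Config d) : MvPowerSeries (Fin 2) ℤ :=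
  MvPowerSeries.X 0 ^ size x * MvPowerSeries.X 1 ^ weight x

/-- `F ∈ ℤ⟦t, q⟧` is a rational function: `F = P / Q` for polynomials `P, Q ∈ ℤ[t, q]`, where
`Q(0, 0) = 1`, so that `Q` is nonzero and the quotient makes sense in `ℤ⟦t, q⟧`. -/
def IsRational (F : MvPowerSeries (Fin 2) ℤ) : Prop :=
  ∃ P Q : MvPolynomial (Fin 2) ℤ, MvPolynomial.constantCoeff Q = 1 ∧
    (Q : MvPowerSeries (Fin 2) ℤ) * F = (P : MvPowerSeries (Fin 2) ℤ)

end SpiralShift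

/-! Code a point by its position on the spiral. Then `g j` sends the code of each point `k ≥ j` to
the next number whose residue mod `d` is one of their seats. This map is increasing and commutes
with translation by `d`. Hence the order of the points survives (`point_g`), the size grows by 1
(`size_g`) and the weight by the 0-based index `j` (`weight_g`), so the content of `a · x` is that
of `x` times a monomial with exponents linear in `a` (`cont_act`).

Distinct `a` give distinct `a · x` (`act_injective`): `g j` is injective and strictly raises the
`j`-th point, which no `g i` with `i > j` touches, so the exponents can be read off from the
outermost operator inwards.

The orbit sum is therefore `cont x₀` times a sum of monomials over the semigroup, which up to `0` is
the image of some `ℕ^n` under an additive map. The lexicographically least elements of the fibres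
form the complement of a monomial ideal (`exists_isUpperSet_bijOn`). By Dickson's lemma and
inclusion-exclusion over shifted orthants, its generating function is rational
(`RationalSum.of_isUpperSet`). -/

namespace SpiralShift

/-! ### Positions on the spiral. -/

/-- The position of a point along the spiral; the height is `(code + 1) / d`. -/
def code {d : ℕ} (p : Point d) : ℕ := d * p.2 + p.1

theorem height_eq_code {d : ℕ} (p : Point d) : height p = ((code p : ℚ) + 1) / d := by
  have hd : (d : ℚ) ≠ 0 := by exact_mod_cast p.1.pos.ne'
  simp only [height, code]
  push_cast
  field_simp
  ring

theorem height_lt_iff {d : ℕ} (p q : Point d) : height p < height q ↔ code p < code q := by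
  have hd : (0 : ℚ) < d := by exact_mod_cast p.1.pos
  rw [height_eq_code, height_eq_code, div_lt_div_iff_of_pos_right hd]
  simp

theorem code_injective (d : ℕ) : Function.Injective (code (d := d)) := by
  intro p q h
  apply height_injective d
  rw [height_eq_code, height_eq_code, h]

theorem code_shift {d : ℕ} (p : Point d) (s : ℕ) : code (shift p s) = code p + s := by
  have := Nat.div_add_mod ((p.1 : ℕ) + s) d
  simp only [code, shift, mul_add]
  omega

theorem code_mod {d : ℕ} (p : Point d) : code p % d = p.1 := by
  simp [code, Nat.mod_eq_of_lt p.1.isLt]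

theorem code_div {d : ℕ} (p : Point d) : code p / d = p.2 := by
  simp [code, Nat.mul_add_div p.1.pos, Nat.div_eq_of_lt p.1.isLt]

theorem floor_height_sub {d : ℕ} {p q : Point d} (h : code q ≤ code p) :
    (⌊height p - height q⌋₊ : ℤ) = ((code p : ℤ) - code q) / d := by
  have h1 : height p - height q = ((code p - code q : ℕ) : ℚ) / (d : ℚ) := by
    rw [height_eq_code, height_eq_code, Nat.cast_sub h]
    ring
  rw [h1, Nat.floor_div_natCast, Nat.floor_natCast]
  push_cast [Nat.cast_sub h]
  rfl

/-! ### The next number with an allowed residue. -/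

/-- `m'` is the least number above `m` whose residue modulo `d` lies in `S`. -/
def IsNext (d : ℕ) (S : Set ℕ) (m m' : ℕ) : Prop :=
  m < m' ∧ m' % d ∈ S ∧ ∀ n, m < n → n < m' → n % d ∉ S

namespace IsNext

variable {d : ℕ} {S : Set ℕ} {m n a b : ℕ}

theorem le (ha : IsNext d S m a) (hn : n % d ∈ S) (h : m < n) : a ≤ n := by
  by_contra! hlt
  exact ha.2.2 n h hlt hn

theorem lt_of_lt (ha : IsNext d S m a) (hb : IsNext d S n b) (hn : n % d ∈ S) (h : m < n) :
    a < b :=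
  (ha.le hn h).trans_lt hb.1

theorem unique (ha : IsNext d S m a) (hb : IsNext d S m b) : a = b :=
  le_antisymm (ha.le hb.2.1 hb.1) (hb.le ha.2.1 ha.1)

theorem le_of_le (ha : IsNext d S m a) (hb : IsNext d S n b) (hn : n % d ∈ S) (h : m ≤ n) :
    a ≤ b := by
  rcases h.eq_or_lt with rfl | h
  · exact (ha.unique hb).le
  · exact (ha.lt_of_lt hb hn h).le

theorem mul_add (ha : IsNext d S m a) (q : ℕ) : IsNext d S (d * q + m) (d * q + a) := by
  refine ⟨by have := ha.1; omega, by simpa using ha.2.1, fun n h1 h2 => ?_⟩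
  have h := ha.2.2 (n - d * q) (by omega) (by omega)
  have h3 : n = d * q + (n - d * q) := by omega
  rwa [h3, Nat.mul_add_mod]

theorem of_mul_add {q : ℕ} (ha : IsNext d S (d * q + m) a) :
    ∃ b, a = d * q + b ∧ IsNext d S m b := by
  obtain ⟨h1, h2, h3⟩ := ha
  obtain ⟨b, rfl⟩ := Nat.exists_eq_add_of_le (show d * q ≤ a by omega)
  refine ⟨b, rfl, by omega, by simpa using h2, fun n hn hn' => ?_⟩
  simpa using h3 (d * q + n) (by omega) (by omega)

/-- With `e = n - m`, `n` lies between the translates of `m` by `d * (e / d)` and `d * (e / d + 1)`.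
Passing to next elements is monotone and commutes with these translations, so `b` lies between the
same translates of `a`. -/
theorem sub_div_eq (hd : 0 < d) (ha : IsNext d S m a) (hb : IsNext d S n b) (hm : m % d ∈ S)
    (hn : n % d ∈ S) (h : m ≤ n) : ((b : ℤ) - a) / d = ((n : ℤ) - m) / d := by
  obtain ⟨e, rfl⟩ := Nat.exists_eq_add_of_le h
  have h1 := Nat.div_add_mod e d
  have h2 := Nat.mod_lt e hd
  have hle : d * (e / d) + a ≤ b := (ha.mul_add (e / d)).le_of_le hb hn (by omega)
  have hlt : b < d * (e / d + 1) + a := by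
    refine hb.lt_of_lt (ha.mul_add (e / d + 1)) (by simpa using hm) ?_
    rw [_root_.mul_add]
    omega
  have e1 : ((m + e : ℕ) : ℤ) - m = (e : ℕ) := by push_cast; ring
  rw [e1, ← Int.natCast_div]
  have hd' : (0 : ℤ) < d := by exact_mod_cast hd
  have hle' : (d : ℤ) * (e / d : ℕ) + a ≤ b := by exact_mod_cast hle
  have hlt' : (b : ℤ) < d * ((e / d : ℕ) + 1) + a := by exact_mod_cast hlt
  apply le_antisymm
  · rw [← Int.lt_add_one_iff, Int.ediv_lt_iff_lt_mul hd']
    linarith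
  · rw [Int.le_ediv_iff_mul_le hd']
    linarith

/-- Moving every residue in `S` to the next one adds up to a full turn. -/
theorem sum_eq {ι : Type*} {T : Finset ι} (hT : T.Nonempty) {s b : ι → ℕ}
    (hs : Set.InjOn s T) (hsd : ∀ i ∈ T, s i < d)
    (hb : ∀ i ∈ T, IsNext d (s '' T) (s i) (b i)) :
    ∑ i ∈ T, b i = ∑ i ∈ T, s i + d := by
  classical
  obtain ⟨i₀, hi₀, hmin⟩ := T.exists_min_image s hT
  have hres : ∀ i ∈ T, s i % d ∈ s '' T := fun i hi => by
    rw [Nat.mod_eq_of_lt (hsd i hi)]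
    exact ⟨i, hi, rfl⟩
  have hbinj : Set.InjOn b T := by
    intro i hi k hk h
    apply hs hi hk
    rcases lt_trichotomy (s i) (s k) with hlt | heq | hlt
    · exact absurd h ((hb i hi).lt_of_lt (hb k hk) (hres k hk) hlt).ne
    · exact heq
    · exact absurd h ((hb k hk).lt_of_lt (hb i hi) (hres i hi) hlt).ne'
  have hnot : s i₀ + d ∉ (T.image s).erase (s i₀) := by
    intro h
    obtain ⟨k, hk, hk'⟩ := Finset.mem_image.mp (Finset.mem_of_mem_erase h)
    have := hsd k hk
    omega
  -- Every residue is taken by its successor, and the largest wraps round to the smallest plus `d`.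
  have himg : T.image b = insert (s i₀ + d) ((T.image s).erase (s i₀)) := by
    apply Finset.eq_of_subset_of_card_le
    · intro y hy
      obtain ⟨i, hi, rfl⟩ := Finset.mem_image.mp hy
      have h1 := hb i hi
      have h2 : b i ≤ s i₀ + d := by
        refine h1.le ?_ ?_
        · simpa using hres i₀ hi₀
        · have := hsd i hi
          omega
      obtain ⟨k, hk, hk'⟩ := h1.2.1
      have h3 := h1.1
      have h4 := hmin i hi
      have h5 := hmin k hk
      rw [Finset.mem_insert, Finset.mem_erase, Finset.mem_image]
      rcases lt_or_ge (b i) d with hlt | hge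
      · rw [Nat.mod_eq_of_lt hlt] at hk'
        exact Or.inr ⟨by omega, k, hk, hk'⟩
      · left
        -- Since `b i ≤ s i₀ + d`, this bounds the residue of `b i` by the minimum `s i₀`, forcing
        -- equality.
        have h6 : b i % d ≤ b i - d := by
          rw [Nat.mod_eq_sub_mod hge]
          exact Nat.mod_le _ _
        omega
    · rw [Finset.card_insert_of_notMem hnot,
        Finset.card_erase_of_mem (Finset.mem_image_of_mem s hi₀),
        Finset.card_image_of_injOn hs, Finset.card_image_of_injOn hbinj]
      exact (Nat.sub_add_cancel hT.card_pos).le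
  have e1 : ∑ i ∈ T, b i = ∑ y ∈ T.image b, y :=
    (Finset.sum_image (f := fun y => y) hbinj).symm
  have e2 : ∑ i ∈ T, s i = ∑ y ∈ T.image s, y :=
    (Finset.sum_image (f := fun y => y) hs).symm
  rw [e1, e2, himg, Finset.sum_insert hnot,
    ← Finset.add_sum_erase _ _ (Finset.mem_image_of_mem s hi₀)]
  ring

end IsNext

/-! ### Effect of one operator on order, size and weight. -/

section Moves

variable {d : ℕ}

theorem code_point_strictMono (x : Config d) : StrictMono fun k => code (point x k) :=
  fun _ _ h => (height_lt_iff _ _).mp (height_point_strictMono x h)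

/-- The seats of the points `δ^k(x)` with `k ≥ j`. -/
def topSeats (x : Config d) (j : Fin d) : Set ℕ :=
  (fun k => (seat x k : ℕ)) '' (Finset.Ici j : Finset (Fin d))

theorem code_point_mod (x : Config d) (k : Fin d) : code (point x k) % d = seat x k :=
  code_mod _

theorem code_point_mod_mem (x : Config d) {j k : Fin d} (h : j ≤ k) :
    code (point x k) % d ∈ topSeats x j := by
  rw [code_point_mod]
  exact ⟨k, by simpa using h, rfl⟩

theorem moved_of_lt (x : Config d) {j k : Fin d} (h : k < j) : moved j x k = point x k := by
  simp [moved, not_le.mpr h]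

/-- The bridge from the definition of `moved` to arithmetic of codes. -/
theorem isNext_moved (x : Config d) {j k : Fin d} (h : j ≤ k) :
    IsNext d (topSeats x j) (code (point x k)) (code (moved j x k)) := by
  obtain ⟨h1, l, h2, h3⟩ := Nat.find_spec (exists_return x h)
  simp only [moved, h, dite_true]
  refine ⟨by rw [code_shift]; omega, ?_, fun n hn hn' hS => ?_⟩
  · rw [code_mod, h3]
    exact ⟨l, by simpa using h2, rfl⟩
  · rw [code_shift] at hn'
    obtain ⟨s, rfl⟩ := Nat.exists_eq_add_of_lt hn
    refine Nat.find_min (exists_return x h) (m := s + 1) (by omega) ⟨by omega, ?_⟩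
    obtain ⟨l, hl, hl'⟩ := hS
    refine ⟨l, by simpa using hl, Fin.ext ?_⟩
    rw [← code_mod, code_shift, ← add_assoc, ← hl']
    rfl

theorem code_moved_strictMono (j : Fin d) (x : Config d) :
    StrictMono fun k => code (moved j x k) := by
  intro k l h
  have h1 := code_point_strictMono x h
  dsimp only at h1 ⊢
  rcases lt_or_ge k j with hk | hk
  · rw [moved_of_lt x hk]
    rcases lt_or_ge l j with hl | hl
    · rwa [moved_of_lt x hl]
    · exact h1.trans (isNext_moved x hl).1
  · exact (isNext_moved x hk).lt_of_lt (isNext_moved x (hk.trans h.le))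
      (code_point_mod_mem x (hk.trans h.le)) h1

theorem range_point (x : Config d) :
    Set.range (point x) = Set.range fun i => ((i, x i) : Point d) := by
  rw [show point x = (fun i => ((i, x i) : Point d)) ∘ seat x from rfl,
    (seat x).surjective.range_comp]

/-- The operators `g_j` do not disturb the order of the points. -/
theorem point_g (j : Fin d) (x : Config d) : point (g j x) = moved j x := by
  have h : (fun k => code (point (g j x) k)) = fun k => code (moved j x k) := by
    -- Two strictly increasing sequences with the same range coincide.
    refine ((code_point_strictMono _).range_inj (code_moved_strictMono j x)).mp ?_
    rw [show (fun k => code (point (g j x) k)) = code ∘ point (g j x) from rfl,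
      show (fun k => code (moved j x k)) = code ∘ moved j x from rfl,
      Set.range_comp, Set.range_comp, range_point, range_g]
  funext k
  exact code_injective d (congrFun h k)

theorem point_injective : Function.Injective (point (d := d)) := by
  intro x y h
  have h1 := range_point x
  rw [h, range_point y] at h1
  funext i
  obtain ⟨k, hk⟩ : ((i, x i) : Point d) ∈ Set.range fun i => ((i, y i) : Point d) := by
    rw [h1]
    exact ⟨i, rfl⟩
  have h2 : k = i := congrArg Prod.fst hk
  have h3 : y k = x i := congrArg Prod.snd hk
  rw [← h3, h2]

theorem sum_code_moved (j : Fin d) (x : Config d) :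
    ∑ k, code (moved j x k) = ∑ k, code (point x k) + d := by
  -- Strip the multiple of `d` from each code, so that `IsNext.sum_eq` applies to the bare seats;
  -- the value 0 below `j` is a dummy.
  have hnext : ∀ k : Fin d, ∃ b, j ≤ k → code (moved j x k) = d * x (seat x k) + b ∧
      IsNext d (topSeats x j) (seat x k) b := by
    intro k
    by_cases h : j ≤ k
    · obtain ⟨b, hb⟩ := IsNext.of_mul_add (isNext_moved x h)
      exact ⟨b, fun _ => hb⟩
    · exact ⟨0, fun h' => absurd h' h⟩
  choose b hb using hnext
  have hsum := IsNext.sum_eq (d := d) (T := Finset.Ici j) ⟨j, by simp⟩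
    (s := fun k => (seat x k : ℕ)) (b := b)
    (fun k _ l _ h => (seat x).injective (Fin.ext h)) (fun k _ => (seat x k).isLt)
    (fun k hk => (hb k (by simpa using hk)).2)
  have hIci : ∑ k ∈ Finset.Ici j, code (moved j x k) =
      ∑ k ∈ Finset.Ici j, code (point x k) + d := by
    have e1 : ∑ k ∈ Finset.Ici j, code (moved j x k) =
        ∑ k ∈ Finset.Ici j, (d * x (seat x k) + b k) :=
      Finset.sum_congr rfl fun k hk => (hb k (by simpa using hk)).1
    have e2 : ∑ k ∈ Finset.Ici j, code (point x k) =
        ∑ k ∈ Finset.Ici j, (d * x (seat x k) + (seat x k : ℕ)) := rfl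
    rw [e1, e2, Finset.sum_add_distrib, Finset.sum_add_distrib, hsum, add_assoc]
  have hcompl : ∑ k ∈ (Finset.Ici j)ᶜ, code (moved j x k) =
      ∑ k ∈ (Finset.Ici j)ᶜ, code (point x k) :=
    Finset.sum_congr rfl fun k hk => by rw [moved_of_lt x (by simpa using hk)]
  rw [← Finset.sum_add_sum_compl (Finset.Ici j), hIci, hcompl,
    ← Finset.sum_add_sum_compl (Finset.Ici j) (fun k => code (point x k))]
  ring

/-- The quotients by `d` of the positions, counted from any base position `c`, add up to one more
after `g_j`. -/
theorem sum_code_sub_div (j : Fin d) (x : Config d) (c : ℤ) :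
    ∑ k, ((code (moved j x k) : ℤ) - c) / d = ∑ k, ((code (point x k) : ℤ) - c) / d + 1 := by
  have hd : (d : ℤ) ≠ 0 := by exact_mod_cast j.pos.ne'
  have hmod : ∀ p : Point d, ((code p : ℤ) - c) % d = (((p.1 : ℕ) : ℤ) - c) % d := by
    intro p
    simp [code, add_sub_assoc]
  -- The seats are only permuted, so the remainders have the same sum and the increase `d` of the
  -- codes goes entirely into the quotients.
  have hres : ∑ k, ((code (moved j x k) : ℤ) - c) % d = ∑ k, ((code (point x k) : ℤ) - c) % d := by
    simp only [hmod]
    rw [(moved_seat_bijective j x).sum_comp fun i : Fin d => (((i : ℕ) : ℤ) - c) % d]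
    exact (Equiv.sum_comp (seat x) fun i : Fin d => (((i : ℕ) : ℤ) - c) % d).symm
  have hsum : ∑ k, ((code (moved j x k) : ℤ) - c) = ∑ k, ((code (point x k) : ℤ) - c) + d := by
    rw [Finset.sum_sub_distrib, Finset.sum_sub_distrib]
    have := sum_code_moved j x
    zify at this
    rw [this]
    ring
  have hsplit : ∀ f : Fin d → ℤ, ∑ k, f k = d * ∑ k, f k / d + ∑ k, f k % d := by
    intro f
    rw [Finset.mul_sum, ← Finset.sum_add_distrib]
    exact Finset.sum_congr rfl fun k _ => (Int.mul_ediv_add_emod _ _).symm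
  rw [hsplit, hsplit fun k => (code (point x k) : ℤ) - c, hres] at hsum
  apply mul_left_cancel₀ hd
  linarith

theorem size_eq (x : Config d) : (size x : ℤ) = ∑ k, ((code (point x k) : ℤ) - 0) / d := by
  have h : ∀ k, ((code (point x k) : ℤ) - 0) / d = (x (seat x k) : ℕ) := by
    intro k
    rw [sub_zero]
    exact_mod_cast code_div (point x k)
  simp only [h, size]
  push_cast
  exact (Equiv.sum_comp (seat x) fun i => (x i : ℤ)).symm

theorem size_g (j : Fin d) (x : Config d) : size (g j x) = size x + 1 := by
  zify
  rw [size_eq, size_eq, point_g, sum_code_sub_div]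

theorem weight_eq (x : Config d) : (weight x : ℤ) =
    ∑ k, ∑ l, if l < k then ((code (point x k) : ℤ) - code (point x l)) / d else 0 := by
  simp only [weight]
  push_cast
  refine Finset.sum_congr rfl fun k _ => ?_
  rw [Finset.sum_filter]
  refine Finset.sum_congr rfl fun l _ => ?_
  split_ifs with h
  · rw [← floor_height_sub (code_point_strictMono x h).le]
  · rfl

/-- Group the pairs by their lower point `l`. If `l < j`, it stays fixed and the quotients based at
it gain 1 in total; if `l ≥ j`, both points of each pair move and `IsNext.sub_div_eq` keeps the
quotient. There are `j` indices of the first kind. -/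
theorem weight_g (j : Fin d) (x : Config d) : weight (g j x) = weight x + j := by
  zify
  rw [weight_eq, weight_eq, point_g, ← sub_eq_iff_eq_add', Finset.sum_comm,
    Finset.sum_comm (γ := Fin d) (f := fun k l => if l < k then _ else _),
    ← Finset.sum_sub_distrib]
  have key : ∀ l : Fin d,
      (∑ k, if l < k then ((code (moved j x k) : ℤ) - code (moved j x l)) / d else 0) -
        (∑ k, if l < k then ((code (point x k) : ℤ) - code (point x l)) / d else 0) =
      if l < j then 1 else 0 := by
    intro l
    split_ifs with hl
    · rw [← sub_eq_iff_eq_add'.mpr (sum_code_sub_div j x (code (point x l))),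
        ← Finset.sum_sub_distrib, ← Finset.sum_sub_distrib]
      refine Finset.sum_congr rfl fun k _ => ?_
      rw [moved_of_lt x hl]
      split_ifs with hk
      · rfl
      · rw [moved_of_lt x ((not_lt.mp hk).trans_lt hl)]
        ring
    · rw [sub_eq_zero]
      refine Finset.sum_congr rfl fun k _ => ?_
      split_ifs with hk
      · have hjl := not_lt.mp hl
        have hjk := hjl.trans hk.le
        exact IsNext.sub_div_eq j.pos (isNext_moved x hjl) (isNext_moved x hjk)
          (code_point_mod_mem x hjl) (code_point_mod_mem x hjk) (code_point_strictMono x hk).le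
      · rfl
  rw [Finset.sum_congr rfl fun l _ => key l, Finset.sum_ite, Finset.sum_const_zero, add_zero,
    Finset.sum_const, show (Finset.univ.filter (· < j)) = Finset.Iio j by ext; simp, Fin.card_Iio]
  simp

theorem topSeats_g (j : Fin d) (x : Config d) : topSeats (g j x) j = topSeats x j := by
  have hsub : topSeats (g j x) j ⊆ topSeats x j := by
    rintro _ ⟨k, hk, rfl⟩
    have h := (isNext_moved x (j := j) (k := k) (by simpa using hk)).2.1
    rwa [← point_g, code_point_mod] at h
  refine Set.eq_of_subset_of_ncard_le hsub ?_
    ((Finset.finite_toSet _).image _)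
  have hinj : ∀ y : Config d, Function.Injective fun k => (seat y k : ℕ) :=
    fun y => Fin.val_injective.comp (seat y).injective
  simp only [topSeats]
  rw [Set.ncard_image_of_injective _ (hinj _), Set.ncard_image_of_injective _ (hinj _)]

/-- The image determines the set of top seats (`topSeats_g`), and the next-element map is injective
on numbers with residues in that set. -/
theorem g_injective (j : Fin d) : Function.Injective (g j) := by
  intro x y h
  have hS : topSeats x j = topSeats y j := by rw [← topSeats_g, h, topSeats_g]
  have hm : moved j x = moved j y := by rw [← point_g, h, point_g]
  apply point_injective
  funext k
  rcases lt_or_ge k j with hk | hk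
  · rw [← moved_of_lt x hk, hm, moved_of_lt y hk]
  · apply code_injective
    have hx := isNext_moved x hk
    have hy := isNext_moved y hk
    have hxm := code_point_mod_mem x hk
    have hym := code_point_mod_mem y hk
    rw [hS, hm] at hx
    rw [hS] at hxm
    rcases lt_trichotomy (code (point x k)) (code (point y k)) with hlt | heq | hlt
    · exact absurd (hx.lt_of_lt hy hym hlt) (lt_irrefl _)
    · exact heq
    · exact absurd (hy.lt_of_lt hx hxm hlt) (lt_irrefl _)

theorem point_g_iterate_of_lt {j k : Fin d} (h : k < j) (n : ℕ) (x : Config d) :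
    point ((g j)^[n] x) k = point x k := by
  induction n with
  | zero => rfl
  | succ n ih => rw [Function.iterate_succ_apply', point_g, moved_of_lt _ h, ih]

theorem code_point_lt_g_iterate (j : Fin d) {n : ℕ} (hn : 0 < n) (x : Config d) :
    code (point x j) < code (point ((g j)^[n] x) j) := by
  induction n, hn using Nat.le_induction with
  | base => simpa [point_g] using (isNext_moved x le_rfl).1
  | succ n _ ih =>
    rw [Function.iterate_succ_apply', point_g]
    exact ih.trans (isNext_moved _ le_rfl).1

end Moves

/-! ### Composites of the operators and freeness. -/

section Action

variable {d : ℕ}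

theorem size_g_iterate (j : Fin d) (n : ℕ) (x : Config d) : size ((g j)^[n] x) = size x + n := by
  induction n with
  | zero => rfl
  | succ n ih => rw [Function.iterate_succ_apply', size_g, ih, add_assoc]

theorem weight_g_iterate (j : Fin d) (n : ℕ) (x : Config d) :
    weight ((g j)^[n] x) = weight x + n * j := by
  induction n with
  | zero => simp
  | succ n ih => rw [Function.iterate_succ_apply', weight_g, ih]; ring

/-- The composition of the `g_j^{a_j}` over the indices `j` in a list. -/
noncomputable def actList (l : List (Fin d)) (a : Fin d → ℕ) : Config d → Config d :=
  (l.map fun j => (g j)^[a j]).foldr (· ∘ ·) id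

theorem actList_cons (j : Fin d) (l : List (Fin d)) (a : Fin d → ℕ) (x : Config d) :
    actList (j :: l) a x = (g j)^[a j] (actList l a x) := rfl

theorem act_eq_actList (a : Fin d → ℕ) : act a = actList (List.finRange d) a := by
  rw [act, actList, List.ofFn_eq_map]

theorem size_actList (l : List (Fin d)) (a : Fin d → ℕ) (x : Config d) :
    size (actList l a x) = size x + (l.map a).sum := by
  induction l with
  | nil => rfl
  | cons j l ih => rw [actList_cons, size_g_iterate, ih, List.map_cons, List.sum_cons]; ring

theorem weight_actList (l : List (Fin d)) (a : Fin d → ℕ) (x : Config d) :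
    weight (actList l a x) = weight x + (l.map fun j => a j * (j : ℕ)).sum := by
  induction l with
  | nil => rfl
  | cons j l ih => rw [actList_cons, weight_g_iterate, ih, List.map_cons, List.sum_cons]; ring

theorem size_act (a : Fin d → ℕ) (x : Config d) : size (act a x) = size x + ∑ j, a j := by
  rw [act_eq_actList, size_actList, Fin.sum_univ_def]

theorem weight_act (a : Fin d → ℕ) (x : Config d) :
    weight (act a x) = weight x + ∑ j, a j * (j : ℕ) := by
  rw [act_eq_actList, weight_actList, Fin.sum_univ_def]

theorem point_actList_of_lt {l : List (Fin d)} {k : Fin d} (h : ∀ j ∈ l, k < j) (a : Fin d → ℕ)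
    (x : Config d) : point (actList l a x) k = point x k := by
  induction l with
  | nil => rfl
  | cons j l ih =>
    rw [actList_cons, point_g_iterate_of_lt (h j List.mem_cons_self),
      ih fun i hi => h i (List.mem_cons_of_mem _ hi)]

/-- After cancelling `m` steps, a positive number of remaining steps would strictly raise the `j`-th
point, against `hyz`. -/
theorem g_iterate_cancel (j : Fin d) {m n : ℕ} {y z : Config d} (hyz : point y j = point z j)
    (hle : m ≤ n) (h : (g j)^[m] y = (g j)^[n] z) : m = n ∧ y = z := by
  obtain ⟨e, rfl⟩ := Nat.exists_eq_add_of_le hle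
  rw [Function.iterate_add_apply] at h
  have h1 := (g_injective j).iterate m h
  rcases Nat.eq_zero_or_pos e with rfl | he
  · exact ⟨rfl, h1⟩
  · have h2 := code_point_lt_g_iterate j he z
    rw [← h1, hyz] at h2
    exact absurd h2 (lt_irrefl _)

theorem actList_inj {l : List (Fin d)} (hl : l.Pairwise (· < ·)) {a b : Fin d → ℕ} {x : Config d}
    (h : actList l a x = actList l b x) : ∀ j ∈ l, a j = b j := by
  induction l with
  | nil => simp
  | cons j l ih =>
    rw [List.pairwise_cons] at hl
    rw [actList_cons, actList_cons] at h
    -- The tail only involves operators of index above `j`, so both sides still have the `j`-th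
    -- point of `x`.
    have hp : point (actList l a x) j = point (actList l b x) j := by
      rw [point_actList_of_lt hl.1, point_actList_of_lt hl.1]
    have key : a j = b j ∧ actList l a x = actList l b x := by
      rcases le_total (a j) (b j) with hle | hle
      · exact g_iterate_cancel j hp hle h
      · obtain ⟨h1, h2⟩ := g_iterate_cancel j hp.symm hle h.symm
        exact ⟨h1.symm, h2.symm⟩
    intro i hi
    rcases List.mem_cons.mp hi with rfl | hi
    · exact key.1
    · exact ih hl.2 key.2 i hi

theorem act_injective (x : Config d) : Function.Injective fun a : Fin d → ℕ => act a x := by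
  intro a b h
  simp only [act_eq_actList] at h
  funext j
  exact actList_inj (List.pairwise_lt_finRange d) h j (List.mem_finRange j)

end Action

/-! ### Closure properties of rational series. -/

namespace IsRational

variable {F G : MvPowerSeries (Fin 2) ℤ}

theorem coe (P : MvPolynomial (Fin 2) ℤ) : IsRational (P : MvPowerSeries (Fin 2) ℤ) :=
  ⟨P, 1, by simp, by simp⟩

theorem add (hF : IsRational F) (hG : IsRational G) : IsRational (F + G) := by
  obtain ⟨P, Q, hQ, h⟩ := hF
  obtain ⟨P', Q', hQ', h'⟩ := hG
  refine ⟨Q' * P + Q * P', Q * Q', by simp [hQ, hQ'], ?_⟩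
  push_cast
  rw [← h, ← h']
  ring

theorem coe_mul (hF : IsRational F) (P : MvPolynomial (Fin 2) ℤ) :
    IsRational ((P : MvPowerSeries (Fin 2) ℤ) * F) := by
  obtain ⟨P', Q, hQ, h⟩ := hF
  refine ⟨P * P', Q, hQ, ?_⟩
  push_cast
  rw [← h]
  ring

theorem sub (hF : IsRational F) (hG : IsRational G) : IsRational (F - G) := by
  have h := hF.add (hG.coe_mul (-1))
  rw [show F - G = F + ((-1 : MvPolynomial (Fin 2) ℤ) : MvPowerSeries (Fin 2) ℤ) * G by
    have : ((-1 : MvPolynomial (Fin 2) ℤ) : MvPowerSeries (Fin 2) ℤ) = -1 := by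
      simpa using map_neg (MvPolynomial.coeToMvPowerSeries.ringHom (σ := Fin 2) (R := ℤ)) 1
    rw [this]
    ring]
  exact h

theorem of_coe_mul {Q : MvPolynomial (Fin 2) ℤ} (hQ : MvPolynomial.constantCoeff Q = 1)
    (h : IsRational ((Q : MvPowerSeries (Fin 2) ℤ) * F)) : IsRational F := by
  obtain ⟨P', Q', hQ', h'⟩ := h
  refine ⟨P', Q' * Q, by simp [hQ, hQ'], ?_⟩
  rw [← h']
  push_cast
  ring

end IsRational

/-! ### Generating functions of sets of exponents. -/

section Monomials

variable {ι : Type*} [Fintype ι]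

/-- The monomial `t^a q^b`. -/
noncomputable def tq (a b : ℕ) : MvPolynomial (Fin 2) ℤ :=
  MvPolynomial.X 0 ^ a * MvPolynomial.X 1 ^ b

theorem tq_add (a b a' b' : ℕ) : tq (a + a') (b + b') = tq a b * tq a' b' := by
  simp only [tq, pow_add]
  ring

theorem cont_eq_tq {d : ℕ} (x : Config d) :
    cont x = (tq (size x) (weight x) : MvPolynomial (Fin 2) ℤ) := by
  simp [cont, tq]

theorem coeff_tq_of_ne {a b : ℕ} {m : Fin 2 →₀ ℕ} (h : m 0 ≠ a) :
    MvPowerSeries.coeff m (tq a b : MvPowerSeries (Fin 2) ℤ) = 0 := by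
  rw [MvPolynomial.coeff_coe, tq, MvPolynomial.X_pow_eq_monomial, MvPolynomial.X_pow_eq_monomial,
    MvPolynomial.monomial_mul, MvPolynomial.coeff_monomial, if_neg]
  rintro rfl
  simp at h

/-- The substitution `z^u ↦ ∏ (t^{r_i} q^{s_i})^{u_i}` of monomials. -/
noncomputable def subst (r s : ι → ℕ) (u : ι → ℕ) : MvPowerSeries (Fin 2) ℤ :=
  (tq (∑ i, u i * r i) (∑ i, u i * s i) : MvPolynomial (Fin 2) ℤ)

theorem subst_add (r s : ι → ℕ) (u v : ι → ℕ) :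
    subst r s (u + v) = subst r s u * subst r s v := by
  simp only [subst, Pi.add_apply, add_mul, Finset.sum_add_distrib, tq_add]
  push_cast
  rfl

/-- The monomials with exponents in `S` add up to a rational function after substitution. -/
def RationalSum (r s : ι → ℕ) (S : Set (ι → ℕ)) : Prop :=
  ∃ F, HasSum (S.indicator (subst r s)) F ∧ IsRational F

variable {r s : ι → ℕ}

/-- As every `r i` is positive, only the finitely many `u` with all `u i ≤ m 0` can contribute to
the coefficient at `m`. -/
theorem summable_indicator_subst (hr : ∀ i, 0 < r i) (S : Set (ι → ℕ)) :
    Summable (S.indicator (subst r s)) := by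
  classical
  rw [MvPowerSeries.WithPiTopology.summable_iff_summable_coeff]
  intro m
  refine summable_of_hasFiniteSupport ?_
  refine (Set.finite_Icc (0 : ι → ℕ) fun _ => m 0).subset fun u hu => ⟨fun i => Nat.zero_le _, ?_⟩
  intro i
  by_contra! hlt
  apply hu
  dsimp only
  rw [Set.indicator_apply]
  split_ifs
  · apply coeff_tq_of_ne
    have h1 : u i * r i ≤ ∑ i, u i * r i :=
      Finset.single_le_sum (f := fun i => u i * r i) (fun _ _ => Nat.zero_le _) (Finset.mem_univ i)
    exact (hlt.trans_le ((Nat.le_mul_of_pos_right (u i) (hr i)).trans h1)).ne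
  · simp

theorem hasSum_indicator_image_add {S : Set (ι → ℕ)} {F : MvPowerSeries (Fin 2) ℤ}
    (h : HasSum (S.indicator (subst r s)) F) (u : ι → ℕ) :
    HasSum (((u + ·) '' S).indicator (subst r s)) (subst r s u * F) := by
  have hinj : Function.Injective (u + · : (ι → ℕ) → ι → ℕ) := add_right_injective u
  have hzero : ∀ v ∉ Set.range (u + · : (ι → ℕ) → ι → ℕ),
      ((u + ·) '' S).indicator (subst r s) v = 0 :=
    fun v hv => Set.indicator_of_notMem (fun h => hv (Set.image_subset_range _ _ h)) _
  rw [← hinj.hasSum_iff hzero]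
  refine (h.mul_left (subst r s u)).congr_fun fun v => ?_
  by_cases hv : v ∈ S
  · rw [Function.comp_apply, Set.indicator_of_mem (Set.mem_image_of_mem _ hv),
      Set.indicator_of_mem hv, subst_add]
  · rw [Function.comp_apply, Set.indicator_of_notMem hv, Set.indicator_of_notMem, mul_zero]
    rwa [hinj.mem_set_image]

namespace RationalSum

theorem image_add {S : Set (ι → ℕ)} (h : RationalSum r s S) (u : ι → ℕ) :
    RationalSum r s ((u + ·) '' S) := by
  obtain ⟨F, hF, hF'⟩ := h
  exact ⟨_, hasSum_indicator_image_add hF u, hF'.coe_mul _⟩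

theorem union {S T : Set (ι → ℕ)} (hS : RationalSum r s S) (hT : RationalSum r s T)
    (h : RationalSum r s (S ∩ T)) : RationalSum r s (S ∪ T) := by
  obtain ⟨F, hF, hF'⟩ := hS
  obtain ⟨G, hG, hG'⟩ := hT
  obtain ⟨H, hH, hH'⟩ := h
  refine ⟨F + G - H, ?_, (hF'.add hG').sub hH'⟩
  have heq : (S ∪ T).indicator (subst r s) = fun v =>
      S.indicator (subst r s) v + T.indicator (subst r s) v - (S ∩ T).indicator (subst r s) v := by
    funext v
    have := congrFun (Set.indicator_union_add_inter (subst r s) S T) v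
    simp only [Pi.add_apply] at this
    rw [← this, add_sub_cancel_right]
  rw [heq]
  exact (hF.add hG).sub hH

theorem compl {S : Set (ι → ℕ)} (hS : RationalSum r s S) (h : RationalSum r s Set.univ) :
    RationalSum r s Sᶜ := by
  obtain ⟨F, hF, hF'⟩ := hS
  obtain ⟨G, hG, hG'⟩ := h
  refine ⟨G - F, ?_, hG'.sub hF'⟩
  rw [Set.indicator_univ] at hG
  rw [Set.indicator_compl]
  exact hG.sub hF

theorem empty : RationalSum r s ∅ :=
  ⟨0, by simp [hasSum_zero], by simpa using IsRational.coe 0⟩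

theorem singleton_zero : RationalSum r s {0} := by
  classical
  refine ⟨subst r s 0, ?_, IsRational.coe _⟩
  have h0 : ({0} : Set (ι → ℕ)).indicator (subst r s) 0 = subst r s 0 := by simp
  rw [← h0]
  exact hasSum_single 0 fun v hv => by simp [hv]

/-- The geometric series over the exponents supported in a finite set of indices. -/
theorem coordinate_face (hr : ∀ i, 0 < r i) (T : Finset ι) :
    RationalSum r s {u | ∀ i ∉ T, u i = 0} := by
  classical
  induction T using Finset.induction_on with
  | empty =>
    have h0 : {u : ι → ℕ | ∀ i ∉ (∅ : Finset ι), u i = 0} = {0} := by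
      ext u
      simp [funext_iff]
    rw [h0]
    exact singleton_zero
  | insert i T hi ih =>
    obtain ⟨F, hF, hF'⟩ := ih
    set A : Set (ι → ℕ) := {u | ∀ k ∉ insert i T, u k = 0} with hA
    set B : Set (ι → ℕ) := {u | ∀ k ∉ T, u k = 0} with hB
    obtain ⟨G, hG⟩ := summable_indicator_subst (s := s) hr A
    refine ⟨G, hG, ?_⟩
    have hdisj : Disjoint B ((Pi.single i 1 + ·) '' A) := by
      rw [Set.disjoint_left]
      rintro _ hu ⟨v, -, rfl⟩
      have := hu i hi
      simp at this
    -- Splitting by `u i = 0` or `u i > 0` gives `G = F + t^{r_i} q^{s_i} G`, hence the denominator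
    -- `1 - t^{r_i} q^{s_i}`.
    have hunion : A = B ∪ (Pi.single i 1 + ·) '' A := by
      ext u
      constructor
      · intro hu
        rcases Nat.eq_zero_or_pos (u i) with h0 | hpos
        · left
          intro k hk
          by_cases hki : k = i
          · rw [hki, h0]
          · exact hu k (by simp [hki, hk])
        · right
          have hle : Pi.single i 1 ≤ u := by
            intro k
            by_cases hki : k = i
            · subst hki
              rw [Pi.single_eq_same]
              exact hpos
            · simp [hki]
          refine ⟨u - Pi.single i 1, fun k hk => ?_, add_tsub_cancel_of_le hle⟩
          rw [Pi.sub_apply, hu k hk, zero_tsub]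
      · rintro (hu | ⟨v, hv, rfl⟩) k hk
        · exact hu k fun h => hk (Finset.mem_insert_of_mem h)
        · have hki : k ≠ i := fun h => hk (h ▸ Finset.mem_insert_self _ _)
          simp [hki, hv k hk]
    have hsum := hF.add (hasSum_indicator_image_add hG (Pi.single i 1))
    have heq : (fun u => B.indicator (subst r s) u +
        ((Pi.single i 1 + ·) '' A).indicator (subst r s) u) = A.indicator (subst r s) := by
      conv_rhs => rw [hunion]
      exact (Set.indicator_union_of_disjoint hdisj _).symm
    rw [heq] at hsum
    have hrec := hG.unique hsum
    refine IsRational.of_coe_mul (Q := 1 - tq (r i) (s i)) ?_ ?_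
    · simp [tq, (hr i).ne']
    · convert hF' using 1
      have h1 : subst r s (Pi.single i 1) = (tq (r i) (s i) : MvPolynomial (Fin 2) ℤ) := by
        simp [subst, Pi.single_apply]
      have h2 : ((1 - tq (r i) (s i) : MvPolynomial (Fin 2) ℤ) : MvPowerSeries (Fin 2) ℤ) =
          1 - (tq (r i) (s i) : MvPowerSeries (Fin 2) ℤ) := by
        simpa using map_sub (MvPolynomial.coeToMvPowerSeries.ringHom (σ := Fin 2) (R := ℤ)) 1
          (tq (r i) (s i))
      rw [h2, ← h1, sub_mul, one_mul, sub_eq_iff_eq_add]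
      exact hrec

theorem univ (hr : ∀ i, 0 < r i) : RationalSum r s Set.univ := by
  convert coordinate_face (s := s) hr Finset.univ using 1
  ext u
  simp

theorem Ici (hr : ∀ i, 0 < r i) (u : ι → ℕ) : RationalSum r s (Set.Ici u) := by
  convert (univ (s := s) hr).image_add u using 1
  ext v
  simp only [Set.mem_Ici, Set.image_univ, Set.mem_range]
  exact ⟨fun h => ⟨v - u, add_tsub_cancel_of_le h⟩, fun ⟨w, hw⟩ => hw ▸ le_self_add⟩

theorem biUnion_Ici (hr : ∀ i, 0 < r i) {κ : Type*} (T : Finset κ) (c : κ → ι → ℕ) :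
    RationalSum r s (⋃ k ∈ T, Set.Ici (c k)) := by
  classical
  induction T using Finset.induction_on generalizing c with
  | empty => simpa using empty
  | insert k T hk ih =>
    rw [Finset.set_biUnion_insert]
    refine (Ici hr (c k)).union (ih c) ?_
    -- The intersection is again a union of orthants, indexed by the smaller set; hence the
    -- induction over all `c`.
    convert ih (fun l => c k ⊔ c l) using 1
    simp only [Set.inter_iUnion, Set.Ici_inter_Ici]

/-- Monomial ideals have rational generating functions. -/
theorem of_isUpperSet (hr : ∀ i, 0 < r i) {U : Set (ι → ℕ)} (hU : IsUpperSet U) :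
    RationalSum r s U := by
  -- Dickson's lemma.
  have hfin : {u | Minimal (· ∈ U) u}.Finite :=
    WellQuasiOrderedLE.finite_of_isAntichain (setOfPred_minimal_antichain (· ∈ U))
  convert biUnion_Ici (s := s) hr hfin.toFinset id using 1
  ext u
  simp only [Set.Finite.mem_toFinset, Set.mem_iUnion, Set.mem_ofPred_eq, id, Set.mem_Ici,
    exists_prop]
  refine ⟨fun hu => ?_, fun ⟨v, hv, hvu⟩ => hU hvu hv.prop⟩
  obtain ⟨v, hvu, hv⟩ := exists_minimal_le_of_wellFoundedLT (· ∈ U) u hu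
  exact ⟨v, hv, hvu⟩

end RationalSum

/-- Every fibre of an additive map has exactly one element in a set of exponents that is the
complement of a monomial ideal: the lexicographically least one. -/
theorem exists_isUpperSet_bijOn {n : ℕ} {M : Type*} [AddCommMonoid M] (φ : (Fin n → ℕ) →+ M) :
    ∃ U : Set (Fin n → ℕ), IsUpperSet U ∧ Set.BijOn φ Uᶜ (Set.range φ) := by
  refine ⟨{u | ∃ v, φ v = φ u ∧ toLex v < toLex u}, ?_, fun u _ => ⟨u, rfl⟩, ?_, ?_⟩
  · rintro u u' hle ⟨v, hv, hlt⟩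
    obtain ⟨e, rfl⟩ := exists_add_of_le hle
    -- The lexicographic order is translation invariant, so a smaller rival of `u` yields one of `u
    -- + e`.
    exact ⟨v + e, by rw [map_add, map_add, hv], by simpa using hlt⟩
  · intro u hu v hv h
    rcases lt_trichotomy (toLex u) (toLex v) with hlt | heq | hlt
    · exact absurd ⟨u, h, hlt⟩ hv
    · exact toLex.injective heq
    · exact absurd ⟨v, h.symm, hlt⟩ hu
  · rintro _ ⟨u, rfl⟩
    obtain ⟨v, hv, hmin⟩ := WellFounded.has_min (wellFounded_lt (α := Lex (Fin n → ℕ)))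
      {v | φ (ofLex v) = φ u} ⟨toLex u, rfl⟩
    refine ⟨ofLex v, ?_, hv⟩
    rintro ⟨w, hw, hlt⟩
    exact hmin (toLex w) (hw.trans hv) hlt

end Monomials

/-! ### Generators of the semigroup and contents along an orbit. -/

section Orbits

variable {d : ℕ}

/-- The content of `a · x` relative to the content of `x`. -/
theorem cont_act (a : Fin d → ℕ) (x : Config d) :
    cont (act a x) = cont x * subst (fun _ => 1) (fun j : Fin d => (j : ℕ)) a := by
  rw [cont_eq_tq, cont_eq_tq, size_act, weight_act, tq_add, subst]
  push_cast
  simp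

/-- A finitely generated semigroup of exponents is, up to `0`, the image of a free commutative
monoid under a map that sends no generator to `0`. -/
theorem exists_generators (A : Finset (Fin d → ℕ)) : ∃ (n : ℕ) (φ : (Fin n → ℕ) →+ Fin d → ℕ),
    (∀ i, φ (Pi.single i 1) ≠ 0) ∧
      (AddSubsemigroup.closure (A : Set (Fin d → ℕ)) : Set (Fin d → ℕ)) ⊆ Set.range φ ∧
      ∀ u, φ u ≠ 0 → φ u ∈ AddSubsemigroup.closure (A : Set (Fin d → ℕ)) := by
  classical
  -- A generator `0` would give the exponent `r i = 0` and destroy summability.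
  let e := (A.erase 0).equivFin.symm
  let φ : (Fin (A.erase 0).card → ℕ) →+ Fin d → ℕ :=
    { toFun := fun u => ∑ i, u i • (e i : Fin d → ℕ)
      map_zero' := by simp
      map_add' := fun u v => by simp [add_smul, Finset.sum_add_distrib] }
  have hsingle : ∀ i, φ (Pi.single i 1) = e i := fun i => by
    simp [φ, Pi.single_apply]
  refine ⟨_, φ, fun i => ?_, ?_, fun u hu => ?_⟩
  · rw [hsingle]
    exact (Finset.mem_erase.mp (e i).2).1
  · intro a ha
    induction ha using AddSubsemigroup.closure_induction with
    | mem a ha =>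
      by_cases h0 : a = 0
      · exact ⟨0, by rw [h0, map_zero]⟩
      · refine ⟨Pi.single (e.symm ⟨a, Finset.mem_erase.mpr ⟨h0, ha⟩⟩) 1, ?_⟩
        rw [hsingle, Equiv.apply_symm_apply]
    | add a b _ _ iha ihb =>
      obtain ⟨u, rfl⟩ := iha
      obtain ⟨v, rfl⟩ := ihb
      exact ⟨u + v, map_add _ _ _⟩
  · have hmem : φ u = 0 ∨ φ u ∈ AddSubsemigroup.closure (A : Set (Fin d → ℕ)) := by
      refine Finset.sum_induction (s := Finset.univ) (fun i => u i • (e i : Fin d → ℕ))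
        (fun a => a = 0 ∨ a ∈ AddSubsemigroup.closure (A : Set (Fin d → ℕ))) ?_ (Or.inl rfl) ?_
      · rintro a b (rfl | ha) (rfl | hb)
        · exact Or.inl (zero_add 0)
        · exact Or.inr (by rwa [zero_add])
        · exact Or.inr (by rwa [add_zero])
        · exact Or.inr (add_mem ha hb)
      · intro i _
        rcases Nat.eq_zero_or_pos (u i) with h0 | hpos
        · exact Or.inl (by rw [h0, zero_smul])
        · have hi : (e i : Fin d → ℕ) ∈ AddSubsemigroup.closure (A : Set (Fin d → ℕ)) :=
            AddSubsemigroup.subset_closure (Finset.mem_of_mem_erase (e i).2)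
          right
          generalize u i = k at hpos
          -- Start at 1, since the closure need not contain the zeroth multiple.
          induction k, Nat.succ_le_of_lt hpos using Nat.le_induction with
          | base => rwa [Nat.succ_eq_add_one, Nat.zero_add, one_smul]
          | succ m hm ih =>
            rw [add_smul, one_smul]
            exact add_mem (ih hm) hi
    exact hmem.resolve_left hu

theorem sum_mul_map (φ : (Fin d → ℕ) →+ ℕ) (u : Fin d → ℕ) :
    ∑ i, u i * φ (Pi.single i 1) = φ u := by
  conv_rhs => rw [pi_eq_sum_univ' u, map_sum]
  exact Finset.sum_congr rfl fun i _ => by rw [map_nsmul, smul_eq_mul]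

/-- The linear form `a ↦ ∑ a_j c_j`. -/
def linearForm (c : Fin d → ℕ) : (Fin d → ℕ) →+ ℕ where
  toFun a := ∑ j, a j * c j
  map_zero' := by simp
  map_add' a b := by simp [add_mul, Finset.sum_add_distrib]

theorem subst_map {n : ℕ} (φ : (Fin n → ℕ) →+ Fin d → ℕ) (r s : Fin d → ℕ) (u : Fin n → ℕ) :
    subst r s (φ u) = subst (fun i => linearForm r (φ (Pi.single i 1)))
      (fun i => linearForm s (φ (Pi.single i 1))) u := by
  have h : ∀ c : Fin d → ℕ, ∑ i, u i * linearForm c (φ (Pi.single i 1)) = ∑ j, φ u j * c j :=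
    fun c => sum_mul_map ((linearForm c).comp φ) u
  simp only [subst, h]

end Orbits

end SpiralShift

/-- Finite generation of the subsemigroup `Γ'` is the hypothesis `hΓ'`. A subsemigroup need not
contain `0`; submonoids are the subsemigroups that do.  The sum over the orbit converges in
`ℤ⟦t, q⟧` (coefficientwise, `ℤ` being discrete) to a rational function. -/
theorem corollary4p6 (d : ℕ) (hd : 1 ≤ d) (x₀ : SpiralShift.Config d)
    (Γ' : AddSubsemigroup (Fin d → ℕ))
    (hΓ' : ∃ A : Finset (Fin d → ℕ), AddSubsemigroup.closure (A : Set (Fin d → ℕ)) = Γ') :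
    ∃ F : MvPowerSeries (Fin 2) ℤ,
      HasSum (fun x : SpiralShift.orbit (Γ' : Set (Fin d → ℕ)) x₀ =>
        SpiralShift.cont (x : SpiralShift.Config d)) F ∧
      SpiralShift.IsRational F := by
  obtain ⟨A, rfl⟩ := hΓ'
  set Γ := AddSubsemigroup.closure (A : Set (Fin d → ℕ))
  obtain ⟨n, φ, hφ, hsub, hmem⟩ := SpiralShift.exists_generators A
  obtain ⟨U, hU, -, hinj, hsurj⟩ := SpiralShift.exists_isUpperSet_bijOn φ
  set r : Fin n → ℕ := fun i => SpiralShift.linearForm (fun _ => 1) (φ (Pi.single i 1))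
  set s : Fin n → ℕ := fun i => SpiralShift.linearForm (fun j => (j : ℕ)) (φ (Pi.single i 1))
  have hr : ∀ i, 0 < r i := by
    intro i
    refine Nat.pos_of_ne_zero fun h => hφ i (funext fun j => ?_)
    have h' : ∑ j, φ (Pi.single i 1) j * 1 = 0 := h
    simpa using Finset.sum_eq_zero_iff.mp h' j (Finset.mem_univ j)
  have hzero : ∀ u, φ u = 0 → u = 0 := by
    intro u hu
    have h : ∑ i, u i * r i = 0 :=
      (SpiralShift.sum_mul_map ((SpiralShift.linearForm fun _ => 1).comp φ) u).trans (by simp [hu])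
    funext i
    exact (mul_eq_zero.mp (Finset.sum_eq_zero_iff.mp h i (Finset.mem_univ i))).resolve_right
      (hr i).ne'
  have hUc := SpiralShift.RationalSum.of_isUpperSet (s := s) hr hU
  -- One exponent vector for each element of `Γ`. If `0 ∉ Γ`, the vector `0`, the only one over `0`,
  -- has to be removed as well.
  have hsum : SpiralShift.RationalSum r s (Uᶜ ∩ φ ⁻¹' Γ) := by
    by_cases h0 : (0 : Fin d → ℕ) ∈ Γ
    · have hset : Uᶜ ∩ φ ⁻¹' (Γ : Set (Fin d → ℕ)) = Uᶜ := by
        refine Set.inter_eq_left.mpr fun u _ => ?_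
        by_cases hu : φ u = 0
        · rw [Set.mem_preimage, hu]
          exact h0
        · exact hmem u hu
      rw [hset]
      exact hUc.compl (.univ hr)
    · have hset : Uᶜ ∩ φ ⁻¹' (Γ : Set (Fin d → ℕ)) = (U ∪ {0})ᶜ := by
        ext u
        rw [Set.compl_union]
        refine and_congr_right fun _ => ⟨?_, fun hu => hmem u fun h => hu (hzero u h)⟩
        rintro hu rfl
        rw [Set.mem_preimage, map_zero] at hu
        exact h0 hu
      rw [hset]
      refine SpiralShift.RationalSum.compl (hUc.union .singleton_zero ?_) (.univ hr)
      rcases Set.subset_singleton_iff_eq.mp (Set.inter_subset_right (s := U) (t := {0})) with h | h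
      · rw [h]
        exact .empty
      · rw [h]
        exact .singleton_zero
  obtain ⟨F, hF, hF'⟩ := hsum
  have hbij : Set.BijOn (fun u => SpiralShift.act (φ u) x₀) (Uᶜ ∩ φ ⁻¹' Γ)
      (SpiralShift.orbit (Γ : Set (Fin d → ℕ)) x₀) := by
    refine ⟨fun u hu => ⟨φ u, hu.2, rfl⟩, ?_, ?_⟩
    · exact fun u hu v hv h => hinj hu.1 hv.1 (SpiralShift.act_injective x₀ h)
    · rintro _ ⟨a, ha, rfl⟩
      obtain ⟨u, hu, rfl⟩ := hsurj (hsub ha)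
      exact ⟨u, ⟨hu, ha⟩, rfl⟩
  refine ⟨SpiralShift.cont x₀ * F, ?_, ?_⟩
  · rw [← (hbij.equiv _).hasSum_iff]
    refine ((hasSum_subtype_iff_indicator.mpr hF).mul_left (SpiralShift.cont x₀)).congr_fun
      fun u => ?_
    exact (SpiralShift.cont_act (φ u) x₀).trans (by rw [SpiralShift.subst_map]; rfl)
  · rw [SpiralShift.cont_eq_tq]
    exact hF'.coe_mul _
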